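/- Let $B$ be the unit ball of $\mathbb{R}^3$ with boundary $\mathbb{S}^2$, surface measure $ds$ and exterior unit normal $\nu$. For $k\in\mathbb{R}$ let $G_k(\mathbf{x})=-\dfrac{e^{ik|\mathbf{x}|}}{4\pi|\mathbf{x}|}$, and let the Neumann–Poincaré operator be $$(\mathcal{K}_B^k)^*[\phi](\mathbf{x})=\mathrm{p.v.}\int_{\mathbb{S}^2}\frac{\partial G_k(\mathbf{x}-\mathbf{y})}{\partial\nu(\mathbf{x})}\,\phi(\mathbf{y})\,ds_{\mathbf{y}},\qquad \mathbf{x}\in\mathbb{S}^2 .$$ Let $n\ge 0$ be an integer. A spherical harmonic of order $n$ is the restriction to $\mathbb{S}^2$ of a homogeneous harmonic polynomial of degree $n$ with complex coefficients, that is, a linear combination of the $Y_n^m$, $-n\le m\le n$. Then for every $k\in\mathbb{R}$ there is exactly one number $\tau_{n,k}\in\mathbb{C}$ such that, for every spherical harmonic $Y$ of order $n$, the principal value exists at every point of $\mathbb{S}^2$ and $$(\mathcal{K}_B^k)^*[Y]=\tau_{n,k}\,Y .$$ Moreover $$\lim_{k\to 0}\tau_{n,k}=\frac{1}{2(2n+1)}=\tau_{n,0},$$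 so that each eigenvalue $\tau_{n,k}$ is continuous in $k$ at $k=0$. -/

import Mathlib

open MeasureTheory Filter Topology

noncomputable section

/-- Euclidean three-space. -/
abbrev Space3 : Type := EuclideanSpace ℝ (Fin 3)

/-- The unit sphere, that is, the boundary of the unit ball `B` of three-space. -/
abbrev UnitSphere : Type := Metric.sphere (0 : Space3) 1

/-- The surface measure of the unit sphere (of total mass `4 π`). -/
def surfaceMeasure : Measure UnitSphere := (volume : Measure Space3).toSphere

/-- The fundamental solution `G_k(x) = - exp(i k |x|) / (4 π |x|)` of `Δ + k²` in three-space;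
`k = 0` gives the fundamental solution `- 1 / (4 π |x|)` of the Laplacian. -/
def helmholtzG (k : ℝ) (x : Space3) : ℂ :=
  -(Complex.exp (Complex.I * (k : ℂ) * (‖x‖ : ℂ)) / (4 * (Real.pi : ℂ) * (‖x‖ : ℂ)))

/-- The kernel `∂ G_k(x - y) / ∂ν(x)` for `x`, `y` on the unit sphere: the derivative of
`z ↦ G_k(z - y)` at `x` in the direction of the exterior unit normal, which is `x` itself. -/
def npKernel (k : ℝ) (x y : UnitSphere) : ℂ :=
  fderiv ℝ (fun z : Space3 => helmholtzG k (z - (y : Space3))) (x : Space3) (x : Space3)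

/-- `HasPVIntegral F x I`: the Cauchy principal value of the integral of `F` over the unit sphere,
with singular point `x`, exists and is equal to `I`. -/
def HasPVIntegral (F : UnitSphere → ℂ) (x : UnitSphere) (I : ℂ) : Prop :=
  (∀ ε : ℝ, 0 < ε → IntegrableOn F {y | ε < dist x y} surfaceMeasure) ∧
    Tendsto (fun ε : ℝ => ∫ y in {y | ε < dist x y}, F y ∂surfaceMeasure) (𝓝[>] 0) (𝓝 I)

/-- `HasNeumannPoincare k φ ψ`: at every point of the unit sphere the principal value integral
defining `(K_B^k)^*[φ]` exists, and `(K_B^k)^*[φ] = ψ`. -/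
def HasNeumannPoincare (k : ℝ) (φ ψ : UnitSphere → ℂ) : Prop :=
  ∀ x : UnitSphere, HasPVIntegral (fun y => npKernel k x y * φ y) x (ψ x)

/-- `Y` is a spherical harmonic of order `n`: the restriction to the unit sphere of a
homogeneous harmonic polynomial of degree `n` in three variables. These functions are the linear
combinations of the `Y_n^m` with `-n ≤ m ≤ n`. The zero function is included. -/
def IsSphericalHarmonic (n : ℕ) (Y : UnitSphere → ℂ) : Prop :=
  ∃ p : MvPolynomial (Fin 3) ℂ, p.IsHomogeneous n ∧
    ∑ i : Fin 3, MvPolynomial.pderiv i (MvPolynomial.pderiv i p) = 0 ∧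
    ∀ x : UnitSphere, Y x = MvPolynomial.eval (fun i => (((x : Space3) i : ℝ) : ℂ)) p

/-- `c` is the eigenvalue of `(K_B^k)^*` on the spherical harmonics of order `n`:
`(K_B^k)^*[Y] = c Y` for all of them. -/
def IsNPEigenvalue (n : ℕ) (k : ℝ) (c : ℂ) : Prop :=
  ∀ Y : UnitSphere → ℂ, IsSphericalHarmonic n Y → HasNeumannPoincare k Y (fun x => c * Y x)

end

/-! On the unit sphere with `r = |x - y|` one has `(x - y) · x = r² / 2`, so the kernel is
`exp(ikr)(1 - ikr) / (8πr)`: it depends on `r` alone and is integrable. Hence the principal value is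
an ordinary integral, and the operator is convolution with a zonal kernel.

The Funk–Hecke formula `funk_hecke` then gives the eigenvalue `4π ∫₀¹ f(u) Q_n(u) du`, where `u = r²
/ 4` and `Q_n(u) = P_n(1 - 2u)` is the shifted Legendre polynomial. It rests on the identity `∫ Δq =
d(d + 1) ∫ q` over the sphere for `q` homogeneous of degree `d`, obtained by integrating by parts
against a Gaussian. Applied to a power of `x · y` times a harmonic `p`, this yields a recurrence for
the zonal moments of `p`, which the moments of `Q_n` also satisfy. Weierstrass approximation and
density in `L¹` pass from polynomials to integrable kernels.

At `k = 0` the kernel is a multiple of `u ^ (-1/2)`, whose Legendre moment is `2 / (2n + 1)`.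
Dominated convergence gives continuity there, and the nonzero harmonic `(x₀ + i x₁)^n` gives
uniqueness. -/

noncomputable section

/-! ### Polynomials as functions on three-space -/

/-- The value of a complex polynomial in three variables at a point of Euclidean space. -/
def polyEval (q : MvPolynomial (Fin 3) ℂ) (y : Space3) : ℂ :=
  MvPolynomial.eval (fun i => ((y i : ℝ) : ℂ)) q

@[simp] lemma polyEval_C (c : ℂ) (y : Space3) : polyEval (MvPolynomial.C c) y = c := by
  simp [polyEval]

@[simp] lemma polyEval_X (i : Fin 3) (y : Space3) :
    polyEval (MvPolynomial.X i) y = ((y i : ℝ) : ℂ) := by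
  simp [polyEval]

@[simp] lemma polyEval_add (p q : MvPolynomial (Fin 3) ℂ) (y : Space3) :
    polyEval (p + q) y = polyEval p y + polyEval q y := by
  simp [polyEval]

@[simp] lemma polyEval_mul (p q : MvPolynomial (Fin 3) ℂ) (y : Space3) :
    polyEval (p * q) y = polyEval p y * polyEval q y := by
  simp [polyEval]

@[simp] lemma polyEval_pow (p : MvPolynomial (Fin 3) ℂ) (m : ℕ) (y : Space3) :
    polyEval (p ^ m) y = polyEval p y ^ m := by
  simp [polyEval]

@[simp] lemma polyEval_zero (y : Space3) : polyEval 0 y = 0 := by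
  simp [polyEval]

@[simp] lemma polyEval_sum {ι : Type*} (s : Finset ι) (p : ι → MvPolynomial (Fin 3) ℂ)
    (y : Space3) : polyEval (∑ i ∈ s, p i) y = ∑ i ∈ s, polyEval (p i) y := by
  simp [polyEval]

@[simp] lemma polyEval_smul (c : ℂ) (p : MvPolynomial (Fin 3) ℂ) (y : Space3) :
    polyEval (c • p) y = c * polyEval p y := by
  simp [polyEval]

@[fun_prop] lemma continuous_polyEval (q : MvPolynomial (Fin 3) ℂ) : Continuous (polyEval q) := by
  unfold polyEval
  exact (MvPolynomial.continuous_eval q).comp (by fun_prop)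

lemma hasLineDerivAt_polyEval (q : MvPolynomial (Fin 3) ℂ) (i : Fin 3) (y : Space3) :
    HasLineDerivAt ℝ (polyEval q) (polyEval (MvPolynomial.pderiv i q) y) y
      (EuclideanSpace.single i 1) := by
  induction q using MvPolynomial.induction_on with
  | C c => simpa [HasLineDerivAt] using hasDerivAt_const (0 : ℝ) c
  | add p q hp hq => simpa [HasLineDerivAt] using HasDerivAt.fun_add hp hq
  | mul_X p j hp =>
    have hX : HasDerivAt (fun t : ℝ => (((y + t • EuclideanSpace.single i (1 : ℝ)) j : ℝ) : ℂ))
        (if j = i then 1 else 0) 0 := by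
      have : HasDerivAt (fun t : ℝ => y j + t * (if j = i then 1 else 0))
          (if j = i then (1 : ℝ) else 0) 0 := by
        simpa using ((hasDerivAt_id (0 : ℝ)).mul_const (if j = i then (1 : ℝ) else 0)).const_add (y j)
      convert! this.ofReal_comp using 1
      · ext t
        by_cases h : j = i <;> simp [h]
      · by_cases h : j = i <;> simp [h]
    have := HasDerivAt.fun_mul hp hX
    simp only [HasLineDerivAt, polyEval_mul, polyEval_X]
    convert! this using 1
    by_cases h : j = i
    · subst h; simp [add_comm, mul_comm]
    · simp [h, mul_comm]

lemma polyEval_smul_point {d : ℕ} {q : MvPolynomial (Fin 3) ℂ} (hq : q.IsHomogeneous d)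
    (r : ℝ) (y : Space3) : polyEval q (r • y) = (r : ℂ) ^ d * polyEval q y := by
  simp only [polyEval, MvPolynomial.eval_eq', Finset.mul_sum]
  refine Finset.sum_congr rfl fun s hs => ?_
  have h : ∑ i : Fin 3, s i = d := by
    have := hq (MvPolynomial.mem_support_iff.mp hs)
    rw [Finsupp.weight_apply, Finsupp.sum_fintype _ _ (by simp)] at this
    simpa using this
  simp only [PiLp.smul_apply, smul_eq_mul, Complex.ofReal_mul, mul_pow, Finset.prod_mul_distrib,
    Finset.prod_pow_eq_pow_sum, h]
  ring

/-! ### Gaussian integration by parts and polar coordinates -/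

/-- The Gaussian weight on Euclidean space. -/
def gaussianWeight (y : Space3) : ℂ := ((Real.exp (-‖y‖ ^ 2 / 2) : ℝ) : ℂ)

lemma hasLineDerivAt_gaussianWeight (i : Fin 3) (y : Space3) :
    HasLineDerivAt ℝ gaussianWeight (-(y i : ℂ) * gaussianWeight y) y
      (EuclideanSpace.single i 1) := by
  have h := (((hasStrictFDerivAt_norm_sq y).hasFDerivAt.hasLineDerivAt
    (EuclideanSpace.single i (1 : ℝ))))
  have h2 := ((HasDerivAt.fun_neg h).div_const 2).exp.ofReal_comp
  simp only [HasLineDerivAt, gaussianWeight]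
  convert! h2 using 1
  simp [EuclideanSpace.inner_single_right]
  ring

lemma integrableOn_pow_mul_exp_neg_sq (N : ℕ) :
    IntegrableOn (fun r : ℝ => r ^ N * Real.exp (-r ^ 2 / 2)) (Set.Ioi 0) := by
  have := (integrable_rpow_mul_exp_neg_mul_sq (b := 1 / 2) (by norm_num) (s := N)
    (by have : (0:ℝ) ≤ N := N.cast_nonneg
        linarith)).integrableOn (s := Set.Ioi 0)
  refine this.congr_fun (fun r _ => ?_) measurableSet_Ioi
  simp only [Real.rpow_natCast]
  congr 2
  ring

lemma integrable_polyEval_mul_gaussianWeight (q : MvPolynomial (Fin 3) ℂ) :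
    Integrable (fun y => polyEval q y * gaussianWeight y) := by
  have hc : Continuous gaussianWeight := by unfold gaussianWeight; fun_prop
  induction q using MvPolynomial.induction_on' with
  | add p q hp hq => simpa only [polyEval_add, add_mul] using! hp.add hq
  | monomial s c =>
    have h1 : Integrable (fun y : Space3 => ‖c‖ * (‖y‖ ^ (s.sum fun _ e => e) *
        Real.exp (-‖y‖ ^ 2 / 2))) := by
      refine Integrable.const_mul ?_ _
      rw [integrable_fun_norm_addHaar (μ := (volume : Measure Space3))
        (f := fun r => r ^ (s.sum fun _ e => e) * Real.exp (-r ^ 2 / 2))]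
      simp only [smul_eq_mul, ← mul_assoc, ← pow_add]
      exact integrableOn_pow_mul_exp_neg_sq _
    refine h1.mono' ((continuous_polyEval _).mul hc).aestronglyMeasurable (ae_of_all _ fun y => ?_)
    simp only [polyEval, MvPolynomial.eval_monomial, gaussianWeight, norm_mul, Complex.norm_real,
      Real.norm_eq_abs, Real.abs_exp, mul_assoc]
    gcongr
    rw [Finsupp.prod, Finsupp.sum, ← Finset.prod_pow_eq_pow_sum, norm_prod]
    refine Finset.prod_le_prod (fun _ _ => norm_nonneg _) fun i _ => ?_
    rw [norm_pow, Complex.norm_real]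
    gcongr
    exact PiLp.norm_apply_le y i

lemma integral_pderiv_mul_gaussianWeight (q : MvPolynomial (Fin 3) ℂ) (i : Fin 3) :
    ∫ y, polyEval (MvPolynomial.pderiv i q) y * gaussianWeight y =
      ∫ y, polyEval (MvPolynomial.X i * q) y * gaussianWeight y := by
  have h := integral_bilinear_hasLineDerivAt_right_eq_neg_left_of_integrable
    (μ := (volume : Measure Space3))
    (B := ContinuousLinearMap.mul ℝ ℂ) (f := polyEval q)
    (f' := polyEval (MvPolynomial.pderiv i q)) (g := gaussianWeight)
    (g' := fun y => -(y i : ℂ) * gaussianWeight y) (v := EuclideanSpace.single i 1)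
    (integrable_polyEval_mul_gaussianWeight _)
    (by
      refine (integrable_polyEval_mul_gaussianWeight (-(MvPolynomial.X i * q))).congr
        (ae_of_all _ fun y => ?_)
      simp [polyEval]
      ring)
    (integrable_polyEval_mul_gaussianWeight _)
    (fun y _ => hasLineDerivAt_polyEval q i y) (fun y _ => hasLineDerivAt_gaussianWeight i y)
  simp only [ContinuousLinearMap.mul_apply'] at h
  rw [← neg_eq_iff_eq_neg, ← integral_neg] at h
  rw [← h]
  congr 1
  ext y
  simp
  ring

/-- The Laplacian of a polynomial in three variables. -/
def polyLaplacian (q : MvPolynomial (Fin 3) ℂ) : MvPolynomial (Fin 3) ℂ :=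
  ∑ i : Fin 3, MvPolynomial.pderiv i (MvPolynomial.pderiv i q)

/-- One integration by parts turns each `∂ᵢ∂ᵢq` into `yᵢ ∂ᵢq`; Euler's identity sums these to `d q`.
-/
lemma integral_polyLaplacian_mul_gaussianWeight {d : ℕ} {q : MvPolynomial (Fin 3) ℂ}
    (hq : q.IsHomogeneous d) :
    ∫ y, polyEval (polyLaplacian q) y * gaussianWeight y =
      d * ∫ y, polyEval q y * gaussianWeight y := by
  have h := hq.sum_X_mul_pderiv
  have h1 : ∀ y, polyEval (∑ i : Fin 3, MvPolynomial.X i * MvPolynomial.pderiv i q) y =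
      d * polyEval q y := by
    intro y
    rw [h]
    simp [polyEval]
  rw [← integral_const_mul]
  simp_rw [← mul_assoc, ← h1, polyLaplacian, polyEval_sum, Finset.sum_mul]
  rw [integral_finsetSum _ fun i _ => integrable_polyEval_mul_gaussianWeight _,
    integral_finsetSum _ fun i _ => integrable_polyEval_mul_gaussianWeight _]
  exact Finset.sum_congr rfl fun i _ => integral_pderiv_mul_gaussianWeight _ i

lemma integral_pow_add_two_mul_exp_neg_sq (d : ℕ) :
    ∫ r in Set.Ioi (0 : ℝ), r ^ (d + 2) * Real.exp (-r ^ 2 / 2) =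
      (d + 1) * ∫ r in Set.Ioi (0 : ℝ), r ^ d * Real.exp (-r ^ 2 / 2) := by
  have key : ∀ N : ℕ, ∫ r in Set.Ioi (0 : ℝ), r ^ N * Real.exp (-r ^ 2 / 2) =
      (1 / 2 : ℝ) ^ (-((N : ℝ) + 1) / 2) * (1 / 2) * Real.Gamma (((N : ℝ) + 1) / 2) := by
    intro N
    rw [← integral_rpow_mul_exp_neg_mul_rpow (p := 2) (q := N) (b := 1 / 2) (by norm_num)
      (by have : (0 : ℝ) ≤ N := N.cast_nonneg
          linarith) (by norm_num)]
    refine setIntegral_congr_fun measurableSet_Ioi fun r _ => ?_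
    simp only [Real.rpow_natCast, Real.rpow_two]
    congr 2
    ring
  rw [key, key]
  have h1 : ((d + 2 : ℕ) + 1 : ℝ) / 2 = ((d : ℝ) + 1) / 2 + 1 := by push_cast; ring
  have h2 : -(((d + 2 : ℕ) : ℝ) + 1) / 2 = -((d : ℝ) + 1) / 2 - 1 := by push_cast; ring
  rw [h1, h2, Real.Gamma_add_one (by positivity), Real.rpow_sub_one (by norm_num)]
  ring

lemma integral_pow_mul_exp_neg_sq_pos (d : ℕ) :
    0 < ∫ r in Set.Ioi (0 : ℝ), r ^ d * Real.exp (-r ^ 2 / 2) := by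
  rw [setIntegral_pos_iff_support_of_nonneg_ae _ (integrableOn_pow_mul_exp_neg_sq d)]
  · have : Function.support (fun r : ℝ => r ^ d * Real.exp (-r ^ 2 / 2)) ∩ Set.Ioi 0 =
        Set.Ioi 0 := by
      refine Set.inter_eq_right.mpr fun r (hr : 0 < r) => ?_
      simp only [Function.mem_support]
      positivity
    rw [this]
    simp
  · filter_upwards [ae_restrict_mem measurableSet_Ioi] with r (hr : 0 < r)
    simp only [Pi.zero_apply]
    positivity

/-- Polar coordinates separate the homogeneous integrand; the exponent `d + 2` is the degree plus
the `r²` of the volume element. -/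
lemma integral_polyEval_mul_gaussianWeight {d : ℕ} {q : MvPolynomial (Fin 3) ℂ}
    (hq : q.IsHomogeneous d) :
    ∫ y, polyEval q y * gaussianWeight y =
      (∫ y : UnitSphere, polyEval q y ∂surfaceMeasure) *
        ((∫ r in Set.Ioi (0 : ℝ), r ^ (d + 2) * Real.exp (-r ^ 2 / 2) : ℝ) : ℂ) := by
  have hdim : Module.finrank ℝ Space3 - 1 = 2 := by simp
  calc
    ∫ y, polyEval q y * gaussianWeight y
      = ∫ y : ({(0)}ᶜ : Set Space3), polyEval q y * gaussianWeight y
          ∂((volume : Measure Space3).comap (↑)) := by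
      rw [integral_subtype_comap (measurableSet_singleton _).compl
        fun y => polyEval q y * gaussianWeight y, restrict_compl_singleton]
    _ = ∫ z : UnitSphere × Set.Ioi (0 : ℝ), polyEval q z.1 *
          (((z.2 : ℝ) ^ d * Real.exp (-(z.2 : ℝ) ^ 2 / 2) : ℝ) : ℂ)
          ∂(surfaceMeasure.prod (Measure.volumeIoiPow 2)) := by
      have h := ((volume : Measure Space3).measurePreserving_homeomorphUnitSphereProd).integral_comp
        (Homeomorph.measurableEmbedding _)
        (fun z : UnitSphere × Set.Ioi (0 : ℝ) => polyEval q z.1 *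
          (((z.2 : ℝ) ^ d * Real.exp (-(z.2 : ℝ) ^ 2 / 2) : ℝ) : ℂ))
      rw [hdim] at h
      rw [surfaceMeasure, ← h]
      refine integral_congr_ae (ae_of_all _ fun y => ?_)
      have hy : ‖(y : Space3)‖ ≠ 0 := norm_ne_zero_iff.mpr y.2
      simp only [homeomorphUnitSphereProd_apply_fst_coe, homeomorphUnitSphereProd_apply_snd_coe,
        polyEval_smul_point hq, gaussianWeight]
      push_cast
      have : ((‖(y : Space3)‖ : ℝ) : ℂ) ≠ 0 := by exact_mod_cast hy
      field_simp
      rw [mul_assoc, ← mul_pow, one_div_mul_cancel this, one_pow, mul_one]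
    _ = (∫ y : UnitSphere, polyEval q y ∂surfaceMeasure) *
        ∫ r : Set.Ioi (0 : ℝ), (((r : ℝ) ^ d * Real.exp (-(r : ℝ) ^ 2 / 2) : ℝ) : ℂ)
          ∂(Measure.volumeIoiPow 2) := by
      have : SFinite surfaceMeasure := by unfold surfaceMeasure; infer_instance
      exact integral_prod_mul (fun y : UnitSphere => polyEval q y)
        (fun r : Set.Ioi (0 : ℝ) => (((r : ℝ) ^ d * Real.exp (-(r : ℝ) ^ 2 / 2) : ℝ) : ℂ))
    _ = _ := by
      congr 1
      rw [integral_complex_ofReal]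
      congr 1
      simp only [Measure.volumeIoiPow, ENNReal.ofReal]
      rw [integral_withDensity_eq_integral_smul
          (measurable_subtype_coe.pow_const _).real_toNNReal,
        integral_subtype_comap measurableSet_Ioi fun r : ℝ =>
          Real.toNNReal (r ^ 2) • (r ^ d * Real.exp (-r ^ 2 / 2))]
      refine setIntegral_congr_fun measurableSet_Ioi fun r hr => ?_
      simp only [NNReal.smul_def, Real.coe_toNNReal _ (pow_nonneg (Set.mem_Ioi.mp hr).le 2),
        smul_eq_mul]
      ring

/-! ### Integrals of Laplacians over the sphere -/

instance : IsFiniteMeasure surfaceMeasure := by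
  unfold surfaceMeasure
  infer_instance

lemma isHomogeneous_polyLaplacian {d : ℕ} {q : MvPolynomial (Fin 3) ℂ}
    (hq : q.IsHomogeneous (d + 2)) : (polyLaplacian q).IsHomogeneous d :=
  MvPolynomial.IsHomogeneous.sum _ _ _ fun _ _ => hq.pderiv.pderiv

lemma polyLaplacian_eq_zero_of_isHomogeneous {d : ℕ} {q : MvPolynomial (Fin 3) ℂ}
    (hq : q.IsHomogeneous d) (hd : d < 2) : polyLaplacian q = 0 := by
  refine Finset.sum_eq_zero fun i _ => ?_
  have h : (MvPolynomial.pderiv i q).IsHomogeneous 0 := by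
    simpa [show d - 1 = 0 by lia] using hq.pderiv (i := i)
  rw [← MvPolynomial.totalDegree_zero_iff_isHomogeneous,
    MvPolynomial.totalDegree_eq_zero_iff_eq_C] at h
  rw [h, MvPolynomial.pderiv_C]

/-- Integrating the Laplacian of a homogeneous polynomial over the unit sphere. -/
lemma integral_sphere_polyLaplacian {d : ℕ} {q : MvPolynomial (Fin 3) ℂ}
    (hq : q.IsHomogeneous d) :
    ∫ y : UnitSphere, polyEval (polyLaplacian q) y ∂surfaceMeasure =
      d * (d + 1) * ∫ y : UnitSphere, polyEval q y ∂surfaceMeasure := by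
  have h := integral_polyLaplacian_mul_gaussianWeight hq
  rw [integral_polyEval_mul_gaussianWeight hq] at h
  rcases Nat.lt_or_ge d 2 with hd | hd
  · simp only [polyLaplacian_eq_zero_of_isHomogeneous hq hd, polyEval_zero, zero_mul,
      integral_zero] at h ⊢
    have hM := (integral_pow_mul_exp_neg_sq_pos (d + 2)).ne'
    rw [eq_comm, mul_eq_zero, mul_eq_zero] at h
    rcases h with h | h | h
    · simp [h]
    · simp [h]
    · exact absurd (by exact_mod_cast h) hM
  · obtain ⟨e, rfl⟩ := Nat.exists_eq_add_of_le' hd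
    -- With `d = e + 2`, the radial moments of `Δq` and `q` have exponents `e + 2` and `e + 4`;
    -- their ratio is the factor `d + 1 = e + 3`.
    rw [integral_polyEval_mul_gaussianWeight (isHomogeneous_polyLaplacian hq),
      integral_pow_add_two_mul_exp_neg_sq (e + 2)] at h
    have hM : ((∫ r in Set.Ioi (0 : ℝ), r ^ (e + 2) * Real.exp (-r ^ 2 / 2) : ℝ) : ℂ) ≠ 0 := by
      exact_mod_cast (integral_pow_mul_exp_neg_sq_pos (e + 2)).ne'
    refine mul_right_cancel₀ hM (h.trans ?_)
    push_cast
    ring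

/-! ### Zonal functions times harmonic polynomials -/

/-- The linear form `y ↦ x · y` as a polynomial. -/
def dotPoly (x : Space3) : MvPolynomial (Fin 3) ℂ :=
  ∑ i : Fin 3, MvPolynomial.C ((x i : ℝ) : ℂ) * MvPolynomial.X i

/-- The derivative of a polynomial in the direction `x`. -/
def dirDeriv (x : Space3) (p : MvPolynomial (Fin 3) ℂ) : MvPolynomial (Fin 3) ℂ :=
  ∑ i : Fin 3, MvPolynomial.C ((x i : ℝ) : ℂ) * MvPolynomial.pderiv i p

lemma isHomogeneous_dotPoly (x : Space3) : (dotPoly x).IsHomogeneous 1 :=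
  MvPolynomial.IsHomogeneous.sum _ _ _ fun i _ => by
    simpa using (MvPolynomial.isHomogeneous_C (Fin 3) ((x i : ℝ) : ℂ)).mul
      (MvPolynomial.isHomogeneous_X ℂ i)

lemma isHomogeneous_dirDeriv (x : Space3) {n : ℕ} {p : MvPolynomial (Fin 3) ℂ}
    (hp : p.IsHomogeneous n) : (dirDeriv x p).IsHomogeneous (n - 1) :=
  MvPolynomial.IsHomogeneous.sum _ _ _ fun i _ => by
    simpa using (MvPolynomial.isHomogeneous_C (Fin 3) ((x i : ℝ) : ℂ)).mul (hp.pderiv (i := i))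

/-- The commutator of two derivations is a derivation, and this one kills every variable. -/
lemma pderiv_pderiv_comm (i j : Fin 3) (p : MvPolynomial (Fin 3) ℂ) :
    MvPolynomial.pderiv i (MvPolynomial.pderiv j p) =
      MvPolynomial.pderiv j (MvPolynomial.pderiv i p) := by
  have h : ⁅MvPolynomial.pderiv (R := ℂ) i, MvPolynomial.pderiv (R := ℂ) j⁆ = 0 := by
    refine MvPolynomial.derivation_ext fun k => ?_
    rw [Derivation.commutator_apply]
    simp [MvPolynomial.pderiv_X, Pi.single_apply, apply_ite]
  have := congrArg (fun D => D p) h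
  rwa [Derivation.commutator_apply, Derivation.zero_apply, sub_eq_zero] at this

/-- Constant-coefficient operators commute. Harmonicity of the derivative lets the induction for
Funk–Hecke descend to degree `n - 1`. -/
lemma polyLaplacian_dirDeriv (x : Space3) {p : MvPolynomial (Fin 3) ℂ}
    (hp : polyLaplacian p = 0) : polyLaplacian (dirDeriv x p) = 0 := by
  have h : polyLaplacian (dirDeriv x p) = dirDeriv x (polyLaplacian p) := by
    simp only [polyLaplacian, dirDeriv, map_sum, MvPolynomial.pderiv_C_mul, Finset.mul_sum]
    rw [Finset.sum_comm]
    refine Finset.sum_congr rfl fun i _ => Finset.sum_congr rfl fun j _ => ?_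
    rw [pderiv_pderiv_comm j i p, pderiv_pderiv_comm j i]
  rw [h, hp]
  simp [dirDeriv]

lemma polyEval_dirDeriv_self {n : ℕ} {p : MvPolynomial (Fin 3) ℂ} (hp : p.IsHomogeneous n)
    (x : Space3) : polyEval (dirDeriv x p) x = n * polyEval p x := by
  have h := congrArg (fun q => polyEval q x) hp.sum_X_mul_pderiv
  simpa [dirDeriv, polyEval_sum, ← Nat.cast_smul_eq_nsmul ℂ] using h

lemma pderiv_dotPoly (x : Space3) (i : Fin 3) :
    MvPolynomial.pderiv i (dotPoly x) = MvPolynomial.C ((x i : ℝ) : ℂ) := by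
  fin_cases i <;> simp [dotPoly, Fin.sum_univ_three, MvPolynomial.pderiv_X]

/-- Leibniz rule: the gradient of `x · y` is the unit vector `x`, and the term in `Δp` vanishes.
Where an exponent is truncated, its coefficient is zero. -/
lemma polyEval_polyLaplacian_dotPoly_pow_mul (x : UnitSphere) (m : ℕ)
    {p : MvPolynomial (Fin 3) ℂ} (hp : polyLaplacian p = 0) (y : Space3) :
    polyEval (polyLaplacian (dotPoly x ^ m * p)) y =
      m * (m - 1 : ℕ) * polyEval (dotPoly x) y ^ (m - 2) * polyEval p y +
        2 * m * polyEval (dotPoly x) y ^ (m - 1) * polyEval (dirDeriv x p) y := by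
  have hx : ∑ i : Fin 3, (((x : Space3) i : ℝ) : ℂ) ^ 2 = 1 := by
    have : ‖(x : Space3)‖ ^ 2 = 1 := by simp
    rw [EuclideanSpace.norm_sq_eq] at this
    simp only [Real.norm_eq_abs, sq_abs] at this
    exact_mod_cast this
  have hp' := congrArg (fun q => polyEval q y) hp
  simp only [polyLaplacian, polyEval_sum, polyEval_zero] at hp'
  have key : ∀ i : Fin 3,
      polyEval (MvPolynomial.pderiv i (MvPolynomial.pderiv i (dotPoly x ^ m * p))) y =
      m * (m - 1 : ℕ) * polyEval (dotPoly x) y ^ (m - 2) * polyEval p y *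
        (((x : Space3) i : ℝ) : ℂ) ^ 2 +
      2 * m * polyEval (dotPoly x) y ^ (m - 1) *
        ((((x : Space3) i : ℝ) : ℂ) * polyEval (MvPolynomial.pderiv i p) y) +
      polyEval (dotPoly x) y ^ m *
        polyEval (MvPolynomial.pderiv i (MvPolynomial.pderiv i p)) y := by
    intro i
    have hC : ∀ k : ℕ, (k : MvPolynomial (Fin 3) ℂ) = MvPolynomial.C (k : ℂ) := by simp
    simp only [MvPolynomial.pderiv_mul, MvPolynomial.pderiv_pow, pderiv_dotPoly, hC,
      map_add, MvPolynomial.pderiv_C, polyEval_add, polyEval_mul, polyEval_pow, polyEval_C,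
      polyEval_zero, Nat.sub_sub, Nat.reduceAdd]
    ring
  simp only [polyLaplacian, polyEval_sum, key, Finset.sum_add_distrib, ← Finset.mul_sum, hx, hp',
    dirDeriv, polyEval_mul, polyEval_C]
  ring

lemma integrable_sphere_of_continuous {f : UnitSphere → ℂ} (hf : Continuous f) :
    Integrable f surfaceMeasure :=
  hf.integrable_of_hasCompactSupport (HasCompactSupport.of_compactSpace f)

@[fun_prop] lemma continuous_polyEval_coe (q : MvPolynomial (Fin 3) ℂ) :
    Continuous fun y : UnitSphere => polyEval q y :=
  (continuous_polyEval q).comp continuous_subtype_val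

/-- The weak form of the spherical Laplace eigenvalue equation, tested with a zonal function. -/
lemma integral_zonal_eq_zero (x : UnitSphere) {n : ℕ} {p : MvPolynomial (Fin 3) ℂ}
    (hn : p.IsHomogeneous n) (hp : polyLaplacian p = 0) (f : Polynomial ℂ) :
    ∫ y : UnitSphere,
      (((Polynomial.X ^ 2 - 1) * f.derivative.derivative + (2 * n + 2 : ℂ) • Polynomial.X *
        f.derivative + (n * (n + 1) : ℂ) • f).eval (polyEval (dotPoly x) y) * polyEval p y -
      2 * f.derivative.eval (polyEval (dotPoly x) y) * polyEval (dirDeriv x p) y)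
        ∂surfaceMeasure = 0 := by
  induction f using Polynomial.induction_on' with
  | add f g hf hg =>
    rw [← add_zero (0 : ℂ)]
    nth_rw 1 [← hf]
    rw [← hg, ← integral_add]
    · refine integral_congr_ae (ae_of_all _ fun y => ?_)
      simp only [Polynomial.derivative_add, Polynomial.eval_add, Polynomial.eval_mul,
        Polynomial.eval_smul, smul_eq_mul]
      ring
    · exact integrable_sphere_of_continuous (by fun_prop)
    · exact integrable_sphere_of_continuous (by fun_prop)
  | monomial m c =>
    -- For `f = t^m` the operator yields `(m + n)(m + n + 1) t^m - m(m - 1) t^(m - 2)`, so the claim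
    -- is the sphere identity for `(x · y)^m p`.
    have h := integral_sphere_polyLaplacian
      (by simpa using ((isHomogeneous_dotPoly x).pow m).mul hn :
        (dotPoly x ^ m * p).IsHomogeneous (m + n))
    simp only [polyEval_polyLaplacian_dotPoly_pow_mul x m hp] at h
    rw [← integral_const_mul, eq_comm, ← sub_eq_zero, ← integral_sub] at h
    · rw [← mul_zero c, ← h, ← integral_const_mul]
      refine integral_congr_ae (ae_of_all _ fun y => ?_)
      simp only [Polynomial.derivative_monomial, Polynomial.eval_add, Polynomial.eval_mul,
        Polynomial.eval_smul, smul_eq_mul, Polynomial.eval_monomial, polyEval_mul, polyEval_pow,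
        Polynomial.eval_sub, Polynomial.eval_pow, Polynomial.eval_X, Polynomial.eval_one]
      rcases m with _ | _ | m
      · simp
        ring
      · simp
        ring
      · push_cast [Nat.add_sub_cancel]
        ring
    · exact integrable_sphere_of_continuous (by fun_prop)
    · exact integrable_sphere_of_continuous (by fun_prop)

/-! ### Recurrence for zonal moments -/

/-- The zonal variable `(1 - x · y) / 2` on the sphere, as a quarter of the squared distance. -/
def zonalVar (x y : UnitSphere) : ℝ := dist x y ^ 2 / 4

lemma polyEval_dotPoly (x y : UnitSphere) :
    polyEval (dotPoly x) y = 1 - 2 * (zonalVar x y : ℂ) := by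
  have h : dist x y ^ 2 = 2 - 2 * inner ℝ (x : Space3) y := by
    rw [Subtype.dist_eq, dist_eq_norm, norm_sub_sq_real]
    simp
    ring
  rw [zonalVar, h, PiLp.inner_apply]
  simp [dotPoly]
  simp only [mul_comm]
  ring

@[fun_prop] lemma continuous_zonalVar (x : UnitSphere) : Continuous (zonalVar x) := by
  unfold zonalVar
  fun_prop

/-- Test with `f(t) = u^(m + 1)`, `u = (1 - t) / 2`. Since `t² - 1 = 4u(u - 1)`, the second-order
term produces no power below `u^m`. -/
lemma integral_zonalVar_pow_succ (x : UnitSphere) {n : ℕ} {p : MvPolynomial (Fin 3) ℂ}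
    (hn : p.IsHomogeneous n) (hp : polyLaplacian p = 0) (m : ℕ) :
    (m + 1 + n) * (m + 2 + n) * ∫ y : UnitSphere, (zonalVar x y : ℂ) ^ (m + 1) * polyEval p y
        ∂surfaceMeasure =
      (m + 1) * (m + 1 + n) * ∫ y : UnitSphere, (zonalVar x y : ℂ) ^ m * polyEval p y
        ∂surfaceMeasure -
      (m + 1) * ∫ y : UnitSphere, (zonalVar x y : ℂ) ^ m * polyEval (dirDeriv x p) y
        ∂surfaceMeasure := by
  have h := integral_zonal_eq_zero x hn hp
    ((Polynomial.C (1 / 2) * (1 - Polynomial.X)) ^ (m + 1))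
  rw [← sub_eq_zero, ← integral_const_mul, ← integral_const_mul, ← integral_const_mul,
    ← integral_sub, ← integral_sub, ← h]
  · refine integral_congr_ae (ae_of_all _ fun y => ?_)
    simp only [polyEval_dotPoly, Polynomial.derivative_pow_succ, Polynomial.derivative_mul,
      Polynomial.derivative_C, Polynomial.derivative_sub, Polynomial.derivative_one,
      Polynomial.derivative_X, Polynomial.derivative_pow, Polynomial.eval_add,
      Polynomial.eval_mul, Polynomial.eval_smul, Polynomial.eval_sub, Polynomial.eval_pow,
      Polynomial.eval_X, Polynomial.eval_one, Polynomial.eval_C, Polynomial.eval_zero, smul_eq_mul]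
    rcases m with _ | m
    · simp
      ring
    · simp
      ring
  all_goals exact integrable_sphere_of_continuous (by fun_prop)

lemma integral_polyEval_eq_zero {n : ℕ} {p : MvPolynomial (Fin 3) ℂ}
    (hn : p.IsHomogeneous n) (hp : polyLaplacian p = 0) (h0 : n ≠ 0) :
    ∫ y : UnitSphere, polyEval p y ∂surfaceMeasure = 0 := by
  have h := integral_sphere_polyLaplacian hn
  rw [hp] at h
  simp only [polyEval_zero, integral_zero, zero_eq_mul] at h
  refine h.resolve_left ?_
  exact_mod_cast mul_ne_zero h0 n.succ_ne_zero

lemma surfaceMeasure_real_univ : surfaceMeasure.real Set.univ = 4 * Real.pi := by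
  rw [surfaceMeasure, Measure.toSphere_real_apply_univ, measureReal_def,
    EuclideanSpace.volume_ball_fin_three]
  have h : 0 ≤ Real.pi * 4 / 3 := by positivity
  simp only [finrank_euclideanSpace, Fintype.card_fin, one_pow, ENNReal.ofReal_one, one_mul]
  simp only [ENNReal.toReal_ofReal h]
  push_cast
  ring

/-! ### Legendre moments -/

/-- The moment `∫ u in 0..1, u ^ s * Q n u` of the shifted Legendre polynomial `Q n`. -/
def legendreMoment : ℕ → ℝ → ℝ
  | 0, s => 1 / (s + 1)
  | n + 1, s => (n - s) / (s + n + 2) * legendreMoment n s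

lemma legendreMoment_zero_right (n : ℕ) (hn : n ≠ 0) : legendreMoment n 0 = 0 := by
  induction n with
  | zero => exact absurd rfl hn
  | succ n ih =>
    rcases eq_or_ne n 0 with rfl | h
    · simp [legendreMoment]
    · simp [legendreMoment, ih h]

/-- The moment is `∏_{j<n} (j - s) / ∏_{j≤n} (s + j + 1)`; shifting `s` by one telescopes both
products. -/
lemma legendreMoment_succ_right (n : ℕ) {s : ℝ} (hs : 0 ≤ s) :
    (s + 1) ^ 2 * legendreMoment n s = (s + 1 - n) * (s + 2 + n) * legendreMoment n (s + 1) := by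
  induction n with
  | zero =>
    simp only [legendreMoment, CharP.cast_eq_zero]
    field_simp
    ring
  | succ n ih =>
    simp only [legendreMoment]
    push_cast
    have h1 : s + n + 2 ≠ 0 := by positivity
    have h2 : s + 1 + n + 2 ≠ 0 := by positivity
    calc (s + 1) ^ 2 * ((n - s) / (s + n + 2) * legendreMoment n s)
        = (n - s) / (s + n + 2) * ((s + 1) ^ 2 * legendreMoment n s) := by ring
      _ = _ := by
        rw [ih]
        field_simp
        ring

/-- This is the relation obeyed by the zonal moments in degree `n + 1`, where the derivative of `p`
along `x` takes the value `(n + 1) p(x)` at `x`. -/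
lemma legendreMoment_recurrence (n : ℕ) {s : ℝ} (hs : 0 ≤ s) :
    (s + 1 + (n + 1)) * (s + 2 + (n + 1)) * legendreMoment (n + 1) (s + 1) =
      (s + 1) * (s + 1 + (n + 1)) * legendreMoment (n + 1) s -
        (s + 1) * (n + 1) * legendreMoment n s := by
  have h := legendreMoment_succ_right n hs
  simp only [legendreMoment]
  have h1 : s + n + 2 ≠ 0 := by positivity
  have h2 : s + 1 + n + 2 ≠ 0 := by positivity
  have h3 : (s + 2 + (n + 1)) * ((n - (s + 1)) / (s + 1 + n + 2)) = n - (s + 1) := by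
    field_simp
    ring
  have h4 : (s + 1 + (n + 1)) * ((n - s) / (s + n + 2)) = n - s := by
    field_simp
    ring
  linear_combination (s + 1 + (n + 1)) * legendreMoment n (s + 1) * h3 -
    (s + 1) * legendreMoment n s * h4 + h

/-- The Funk–Hecke formula for powers of the zonal variable. -/
lemma integral_zonalVar_pow (x : UnitSphere) (m : ℕ) : ∀ {n : ℕ} {p : MvPolynomial (Fin 3) ℂ},
    p.IsHomogeneous n → polyLaplacian p = 0 →
    ∫ y : UnitSphere, (zonalVar x y : ℂ) ^ m * polyEval p y ∂surfaceMeasure =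
      4 * Real.pi * legendreMoment n m * polyEval p x := by
  induction m with
  | zero =>
    intro n p hn hp
    rcases eq_or_ne n 0 with rfl | h0
    · rw [← MvPolynomial.totalDegree_zero_iff_isHomogeneous,
        MvPolynomial.totalDegree_eq_zero_iff_eq_C] at hn
      rw [hn]
      simp [legendreMoment, surfaceMeasure_real_univ]
    · simpa [legendreMoment_zero_right n h0] using integral_polyEval_eq_zero hn hp h0
  | succ m ih =>
    intro n p hn hp
    have h := integral_zonalVar_pow_succ x hn hp m
    -- The induction hypothesis is needed for `p` and for its derivative, of different degrees;
    -- hence `n` and `p` are quantified inside the induction.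
    rw [ih hn hp, ih (isHomogeneous_dirDeriv x hn) (polyLaplacian_dirDeriv x hp),
      polyEval_dirDeriv_self hn] at h
    have hne : ((m : ℂ) + 1 + n) * (m + 2 + n) ≠ 0 := by
      norm_cast
      positivity
    refine mul_left_cancel₀ hne (h.trans ?_)
    rcases n with _ | n
    · simp only [legendreMoment]
      push_cast
      have h1 : (m : ℂ) + 1 ≠ 0 := by norm_cast
      have h2 : (m : ℂ) + 1 + 1 ≠ 0 := by norm_cast
      field_simp
      ring
    · have hr := congrArg (fun r : ℝ => (r : ℂ)) (legendreMoment_recurrence n m.cast_nonneg)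
      push_cast at hr ⊢
      linear_combination (-4 * Real.pi * polyEval p x) * hr

/-- The shifted Legendre polynomial as a real function. -/
def legendreFun (n : ℕ) (u : ℝ) : ℝ := Polynomial.aeval u (Polynomial.shiftedLegendre n)

@[fun_prop] lemma continuous_legendreFun (n : ℕ) : Continuous (legendreFun n) := by
  unfold legendreFun
  fun_prop

/-- The coefficients of the shifted Legendre polynomial. -/
def legendreCoeff (n k : ℕ) : ℝ := (-1) ^ k * n.choose k * (n + k).choose n

lemma legendreFun_eq_sum (n : ℕ) (u : ℝ) :
    legendreFun n u = ∑ k ∈ Finset.range (n + 1), legendreCoeff n k * u ^ k := by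
  simp [legendreFun, Polynomial.shiftedLegendre, legendreCoeff]

/-- The sum is `Q_n(1)`, computed from `Q_n(0) = 1` and the symmetry `u ↦ 1 - u`. -/
lemma sum_legendreCoeff (n : ℕ) :
    ∑ k ∈ Finset.range (n + 1), legendreCoeff n k = (-1) ^ n := by
  have h0 : legendreFun n 0 = 1 := by
    rw [legendreFun_eq_sum, Finset.sum_range_succ']
    simp [legendreCoeff]
  have h1 : legendreFun n 1 = (-1) ^ n := by
    rw [legendreFun, Polynomial.shiftedLegendre_eval_symm, sub_self]
    rw [← legendreFun, h0, mul_one]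
  rw [← h1, legendreFun_eq_sum]
  simp

lemma legendreCoeff_succ (n k : ℕ) :
    ((n : ℝ) + 1 - k) * legendreCoeff (n + 1) k = (n + 1 + k) * legendreCoeff n k := by
  rcases Nat.lt_or_ge (n + 1) k with hk | hk
  · simp [legendreCoeff, Nat.choose_eq_zero_of_lt hk, Nat.choose_eq_zero_of_lt (by lia : n < k)]
  have h1 : (n.choose k : ℝ) * (n + 1) = (n + 1).choose k * (n + 1 - k) := by
    have := congrArg (fun a : ℕ => (a : ℝ)) (Nat.choose_mul_succ_eq n k)
    push_cast [Nat.cast_sub hk] at this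
    exact this
  have h2 : ((n : ℝ) + k + 1) * (n + k).choose n = (n + 1 + k).choose (n + 1) * (n + 1) := by
    have := congrArg (fun a : ℕ => (a : ℝ)) (Nat.add_one_mul_choose_eq (n + k) n)
    rw [show n + 1 + k = n + k + 1 by ring]
    push_cast at this
    exact this
  simp only [legendreCoeff]
  have h3 : (n : ℝ) + 1 ≠ 0 := by positivity
  refine mul_right_cancel₀ h3 ?_
  linear_combination (-(-1) ^ k * ((n : ℝ) + 1) * (n + 1 + k).choose (n + 1)) * h1 -
    (-1) ^ k * (n + 1) * n.choose k * h2

/-- Write `s + n + 2 = (s + k + 1) + (n + 1 - k)` and `n - s = (n + 1 + k) - (s + k + 1)`. The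
fractional parts agree by `legendreCoeff_succ`, the remainders because both equal `(-1)^(n + 1)`. -/
lemma sum_legendreCoeff_div (n : ℕ) {s : ℝ} (hs : -1 < s) :
    ∑ k ∈ Finset.range (n + 1), legendreCoeff n k / (s + k + 1) = legendreMoment n s := by
  induction n with
  | zero => simp [legendreCoeff, legendreMoment]
  | succ n ih =>
    have hk : ∀ k : ℕ, s + k + 1 ≠ 0 := fun k => by
      have : (0 : ℝ) ≤ k := k.cast_nonneg
      linarith
    have hn : s + n + 2 ≠ 0 := by
      have : (0 : ℝ) ≤ n := n.cast_nonneg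
      linarith
    have hlast : legendreCoeff n (n + 1) = 0 := by simp [legendreCoeff]
    rw [legendreMoment, ← ih, eq_comm, div_mul_eq_mul_div, div_eq_iff hn, mul_comm _ (s + n + 2),
      Finset.mul_sum, Finset.mul_sum]
    have e1 : ∀ k ∈ Finset.range (n + 1 + 1), (s + n + 2) * (legendreCoeff (n + 1) k / (s + k + 1))
        = legendreCoeff (n + 1) k + (n + 1 + k) * legendreCoeff n k / (s + k + 1) := by
      intro k _
      rw [← legendreCoeff_succ]
      have := hk k
      field_simp
      ring
    have e2 : ∀ k ∈ Finset.range (n + 1), (n - s) * (legendreCoeff n k / (s + k + 1))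
        = -legendreCoeff n k + (n + 1 + k) * legendreCoeff n k / (s + k + 1) := by
      intro k _
      have := hk k
      field_simp
      ring
    rw [Finset.sum_congr rfl e1, Finset.sum_congr rfl e2, Finset.sum_add_distrib,
      Finset.sum_add_distrib, sum_legendreCoeff, Finset.sum_neg_distrib, sum_legendreCoeff,
      Finset.sum_range_succ _ (n + 1), hlast]
    ring

/-- Real exponents are allowed because the static kernel requires `s = -1/2`. -/
lemma integral_rpow_mul_legendreFun (n : ℕ) {s : ℝ} (hs : -1 < s) :
    ∫ u in (0 : ℝ)..1, u ^ s * legendreFun n u = legendreMoment n s := by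
  have hk : ∀ k : ℕ, -1 < s + k := fun k => by
    have : (0 : ℝ) ≤ k := k.cast_nonneg
    linarith
  have h : ∀ u ∈ Set.Ioc (0 : ℝ) 1, u ^ s * legendreFun n u =
      ∑ k ∈ Finset.range (n + 1), legendreCoeff n k * u ^ (s + k) := by
    intro u hu
    rw [legendreFun_eq_sum, Finset.mul_sum]
    refine Finset.sum_congr rfl fun k _ => ?_
    rw [Real.rpow_add hu.1, Real.rpow_natCast]
    ring
  rw [intervalIntegral.integral_of_le zero_le_one, setIntegral_congr_fun measurableSet_Ioc h,
    ← intervalIntegral.integral_of_le zero_le_one, intervalIntegral.integral_finsetSum,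
    ← sum_legendreCoeff_div n hs]
  · refine Finset.sum_congr rfl fun k _ => ?_
    rw [intervalIntegral.integral_const_mul, integral_rpow (Or.inl (hk k)), Real.one_rpow,
      Real.zero_rpow (by linarith [hk k])]
    ring
  · exact fun k _ => (intervalIntegral.intervalIntegrable_rpow' (hk k)).const_mul _

/-- The successive factors `(2n + 1) / (2n + 3)` telescope. -/
lemma legendreMoment_neg_half (n : ℕ) : legendreMoment n (-1 / 2) = 2 / (2 * n + 1) := by
  induction n with
  | zero => norm_num [legendreMoment]
  | succ n ih =>
    rw [legendreMoment, ih]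
    push_cast
    have h1 : (2 * n + 1 : ℝ) ≠ 0 := by positivity
    have h2 : (2 * n + 3 : ℝ) ≠ 0 := by positivity
    rw [show ((n : ℝ) - -1 / 2) = (2 * n + 1) / 2 by ring,
      show (-1 / 2 + n + 2 : ℝ) = (2 * n + 3) / 2 by ring,
      show (2 * ((n : ℝ) + 1) + 1) = 2 * n + 3 by ring]
    field_simp

/-! ### Funk–Hecke: from polynomials to integrable kernels -/

/-- The Funk–Hecke formula for polynomials in the zonal variable. -/
lemma integral_polynomial_zonalVar (x : UnitSphere) {n : ℕ} {p : MvPolynomial (Fin 3) ℂ}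
    (hn : p.IsHomogeneous n) (hp : polyLaplacian p = 0) (f : Polynomial ℂ) :
    ∫ y : UnitSphere, f.eval (zonalVar x y : ℂ) * polyEval p y ∂surfaceMeasure =
      4 * Real.pi * (∫ u in Set.Ioc (0 : ℝ) 1, f.eval (u : ℂ) * (legendreFun n u : ℂ)) *
        polyEval p x := by
  have hint : ∀ g : Polynomial ℂ,
      IntegrableOn (fun u : ℝ => g.eval (u : ℂ) * (legendreFun n u : ℂ)) (Set.Ioc (0 : ℝ) 1) :=
    fun g => (Continuous.integrableOn_Icc (by fun_prop)).mono_set Set.Ioc_subset_Icc_self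
  have hint' : ∀ g : Polynomial ℂ,
      Integrable (fun y : UnitSphere => g.eval (zonalVar x y : ℂ) * polyEval p y) surfaceMeasure :=
    fun g => integrable_sphere_of_continuous (by fun_prop)
  induction f using Polynomial.induction_on' with
  | add f g hf hg =>
    simp only [Polynomial.eval_add, add_mul]
    rw [integral_add (hint' f) (hint' g), integral_add (hint f) (hint g), hf, hg]
    ring
  | monomial m c =>
    simp only [Polynomial.eval_monomial, mul_assoc]
    rw [integral_const_mul, integral_const_mul, integral_zonalVar_pow x m hn hp,
      ← integral_rpow_mul_legendreFun n (by linarith [m.cast_nonneg (α := ℝ)] : (-1 : ℝ) < m),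
      intervalIntegral.integral_of_le zero_le_one, ← integral_complex_ofReal]
    simp only [Real.rpow_natCast]
    push_cast
    ring

lemma zonalVar_mem_Icc (x y : UnitSphere) : zonalVar x y ∈ Set.Icc (0 : ℝ) 1 := by
  have h : dist x y ≤ 2 := by
    have := dist_triangle (x : Space3) 0 y
    simp only [dist_zero_right, dist_zero_left, norm_eq_of_mem_sphere] at this
    rw [Subtype.dist_eq]
    linarith
  have h0 : 0 ≤ dist x y := dist_nonneg
  constructor
  · unfold zonalVar
    positivity
  · unfold zonalVar
    nlinarith

/-- Archimedes: the zonal variable is uniformly distributed. -/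
lemma map_zonalVar (x : UnitSphere) :
    surfaceMeasure.map (zonalVar x) =
      ENNReal.ofReal (4 * Real.pi) • (volume : Measure ℝ).restrict (Set.Ioc 0 1) := by
  have hm : Measurable (zonalVar x) := (continuous_zonalVar x).measurable
  have : IsFiniteMeasure
      (ENNReal.ofReal (4 * Real.pi) • (volume : Measure ℝ).restrict (Set.Ioc 0 1)) :=
    Measure.smul_finite _ ENNReal.ofReal_ne_top
  refine ext_of_forall_integral_eq_of_IsFiniteMeasure fun f => ?_
  rw [integral_map hm.aemeasurable f.continuous.aestronglyMeasurable, integral_smul_measure,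
    ENNReal.toReal_ofReal (by positivity), smul_eq_mul]
  have hpoly : ∀ g : Polynomial ℝ, ∫ y, g.eval (zonalVar x y) ∂surfaceMeasure =
      4 * Real.pi * ∫ u in Set.Ioc (0 : ℝ) 1, g.eval u := by
    intro g
    -- Polynomial moments of the law of `u` come from Funk–Hecke in degree zero, with `p = 1`.
    have h := integral_polynomial_zonalVar x (MvPolynomial.isHomogeneous_one (Fin 3) ℂ)
      (by simp [polyLaplacian]) (g.map (algebraMap ℝ ℂ))
    have h1 : ∀ u : ℝ, (g.map (algebraMap ℝ ℂ)).eval (u : ℂ) = ((g.eval u : ℝ) : ℂ) := by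
      intro u
      rw [← Complex.coe_algebraMap, Polynomial.eval_map_algebraMap, Polynomial.aeval_algebraMap_apply]
      simp
    have h2 : ∀ u : ℝ, legendreFun 0 u = 1 := by simp [legendreFun_eq_sum, legendreCoeff]
    have h3 : ∀ y : Space3, polyEval 1 y = 1 := by simp [polyEval]
    simp only [h1, h2, h3, Complex.ofReal_one, mul_one, integral_complex_ofReal] at h
    exact_mod_cast h
  refine eq_of_forall_dist_le fun ε hε => ?_
  -- Both measures have mass `4π`, so each side is off by at most `ε / 2`.
  obtain ⟨g, hg⟩ := exists_polynomial_near_of_continuousOn 0 1 f f.continuous.continuousOn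
    (ε / (8 * Real.pi)) (by positivity)
  have hi : Integrable (fun y => f (zonalVar x y)) surfaceMeasure :=
    (by fun_prop : Continuous fun y => f (zonalVar x y)).integrable_of_hasCompactSupport
      (HasCompactSupport.of_compactSpace _)
  have hi' : Integrable (fun y => g.eval (zonalVar x y)) surfaceMeasure :=
    (by fun_prop : Continuous fun y => g.eval (zonalVar x y)).integrable_of_hasCompactSupport
      (HasCompactSupport.of_compactSpace _)
  have hj : IntegrableOn f (Set.Ioc (0 : ℝ) 1) :=
    f.continuous.integrableOn_Icc.mono_set Set.Ioc_subset_Icc_self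
  have hj' : IntegrableOn (fun u => g.eval u) (Set.Ioc (0 : ℝ) 1) :=
    (Polynomial.continuous g).integrableOn_Icc.mono_set Set.Ioc_subset_Icc_self
  have b1 : |∫ y, (g.eval (zonalVar x y) - f (zonalVar x y)) ∂surfaceMeasure| ≤
      ε / (8 * Real.pi) * (4 * Real.pi) := by
    rw [← surfaceMeasure_real_univ]
    exact norm_integral_le_of_norm_le_const
      (f := fun y => g.eval (zonalVar x y) - f (zonalVar x y))
      (ae_of_all _ fun y => (hg _ (zonalVar_mem_Icc x y)).le)
  have b2 : |∫ u in Set.Ioc (0 : ℝ) 1, (g.eval u - f u)| ≤ ε / (8 * Real.pi) := by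
    have := norm_setIntegral_le_of_norm_le_const (μ := (volume : Measure ℝ))
      (s := Set.Ioc (0 : ℝ) 1) (f := fun u => g.eval u - f u) (by simp)
      (fun u hu => (hg u (Set.Ioc_subset_Icc_self hu)).le)
    simpa using this
  rw [integral_sub hi' hi, hpoly] at b1
  rw [integral_sub hj' hj] at b2
  rw [Real.dist_eq]
  have hpi := Real.pi_pos
  have e : ε / (8 * Real.pi) * (4 * Real.pi) = ε / 2 := by field_simp; ring
  calc |∫ y, f (zonalVar x y) ∂surfaceMeasure - 4 * Real.pi * ∫ u in Set.Ioc (0 : ℝ) 1, f u|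
      = |-(4 * Real.pi * (∫ u in Set.Ioc (0 : ℝ) 1, g.eval u) -
          ∫ y, f (zonalVar x y) ∂surfaceMeasure) +
          4 * Real.pi * ((∫ u in Set.Ioc (0 : ℝ) 1, g.eval u) -
            ∫ u in Set.Ioc (0 : ℝ) 1, f u)| := by ring_nf
    _ ≤ _ + _ := abs_add_le _ _
    _ ≤ ε / 2 + 4 * Real.pi * (ε / (8 * Real.pi)) := by
      rw [abs_neg, abs_mul, abs_of_pos (by positivity : 0 < 4 * Real.pi), ← e]
      gcongr
    _ = ε := by rw [mul_comm, e]; ring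

lemma integrable_comp_zonalVar (x : UnitSphere) {f : ℝ → ℂ}
    (hf : IntegrableOn f (Set.Ioc 0 1)) :
    Integrable (fun y => f (zonalVar x y)) surfaceMeasure := by
  have h : Integrable f (surfaceMeasure.map (zonalVar x)) := by
    rw [map_zonalVar]
    exact Integrable.smul_measure hf ENNReal.ofReal_ne_top
  exact h.comp_measurable (continuous_zonalVar x).measurable

lemma integral_norm_comp_zonalVar (x : UnitSphere) {f : ℝ → ℂ}
    (hf : IntegrableOn f (Set.Ioc 0 1)) :
    ∫ y, ‖f (zonalVar x y)‖ ∂surfaceMeasure =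
      4 * Real.pi * ∫ u in Set.Ioc (0 : ℝ) 1, ‖f u‖ := by
  have h : Integrable f (surfaceMeasure.map (zonalVar x)) := by
    rw [map_zonalVar]
    exact Integrable.smul_measure hf ENNReal.ofReal_ne_top
  rw [← integral_map (f := fun u => ‖f u‖) (continuous_zonalVar x).measurable.aemeasurable
    h.1.norm, map_zonalVar, integral_smul_measure, ENNReal.toReal_ofReal (by positivity),
    smul_eq_mul]

/-- Continuous functions are dense in `L¹`; Weierstrass then applies to real and imaginary parts
separately. -/
lemma exists_polynomial_integral_norm_sub_le {f : ℝ → ℂ} (hf : IntegrableOn f (Set.Ioc 0 1))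
    {ε : ℝ} (hε : 0 < ε) :
    ∃ g : Polynomial ℂ, ∫ u in Set.Ioc (0 : ℝ) 1, ‖f u - g.eval (u : ℂ)‖ ≤ ε := by
  obtain ⟨h, hh, hhi⟩ := Integrable.exists_boundedContinuous_integral_sub_le hf (half_pos hε)
  obtain ⟨a, ha⟩ := exists_polynomial_near_of_continuousOn 0 1 (fun u => (h u).re)
    (by fun_prop) (ε / 4) (by positivity)
  obtain ⟨b, hb⟩ := exists_polynomial_near_of_continuousOn 0 1 (fun u => (h u).im)
    (by fun_prop) (ε / 4) (by positivity)
  let g : Polynomial ℂ := a.map (algebraMap ℝ ℂ) + Polynomial.C Complex.I * b.map (algebraMap ℝ ℂ)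
  have hmap : ∀ (q : Polynomial ℝ) (u : ℝ),
      (q.map (algebraMap ℝ ℂ)).eval (u : ℂ) = ((q.eval u : ℝ) : ℂ) := by
    intro q u
    rw [← Complex.coe_algebraMap, Polynomial.eval_map_algebraMap, Polynomial.aeval_algebraMap_apply]
    simp
  have hg : ∀ u ∈ Set.Icc (0 : ℝ) 1, ‖h u - g.eval (u : ℂ)‖ ≤ ε / 2 := by
    intro u hu
    refine (Complex.norm_le_abs_re_add_abs_im _).trans ?_
    have h1 := ha u hu
    have h2 := hb u hu
    rw [abs_sub_comm] at h1 h2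
    simp only [g, Polynomial.eval_add, Polynomial.eval_mul, Polynomial.eval_C, hmap,
      Complex.sub_re, Complex.sub_im, Complex.add_re, Complex.add_im, Complex.ofReal_re,
      Complex.ofReal_im, Complex.mul_re, Complex.mul_im, Complex.I_re, Complex.I_im]
    simp only [zero_mul, one_mul, mul_zero, sub_zero, add_zero, zero_add]
    linarith
  have hc : Continuous fun u : ℝ => g.eval (u : ℂ) := by fun_prop
  have hgi : IntegrableOn (fun u : ℝ => g.eval (u : ℂ)) (Set.Ioc 0 1) :=
    hc.integrableOn_Icc.mono_set Set.Ioc_subset_Icc_self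
  refine ⟨g, ?_⟩
  calc ∫ u in Set.Ioc (0 : ℝ) 1, ‖f u - g.eval (u : ℂ)‖
      ≤ ∫ u in Set.Ioc (0 : ℝ) 1, (‖f u - h u‖ + ε / 2) := by
        refine setIntegral_mono_on (Integrable.norm (hf.sub hgi))
          ((Integrable.norm (hf.sub hhi)).add (integrable_const _)) measurableSet_Ioc fun u hu => ?_
        exact (norm_sub_le_norm_sub_add_norm_sub _ (h u) _).trans
          (by gcongr; exact hg u (Set.Ioc_subset_Icc_self hu))
    _ = (∫ u in Set.Ioc (0 : ℝ) 1, ‖f u - h u‖) + ε / 2 := by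
        have hi : IntegrableOn (fun u => ‖f u - h u‖) (Set.Ioc 0 1) :=
          Integrable.norm (hf.sub hhi)
        rw [integral_add hi (integrable_const _)]
        simp
    _ ≤ ε := by linarith

lemma integrable_zonal_mul_polyEval (x : UnitSphere) (p : MvPolynomial (Fin 3) ℂ) {f : ℝ → ℂ}
    (hf : IntegrableOn f (Set.Ioc 0 1)) :
    Integrable (fun y : UnitSphere => f (zonalVar x y) * polyEval p y) surfaceMeasure := by
  obtain ⟨C, hC⟩ := isCompact_univ.exists_bound_of_continuousOn
    (continuous_polyEval_coe p).continuousOn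
  exact (integrable_comp_zonalVar x hf).mul_bdd (c := C)
    (continuous_polyEval_coe p).aestronglyMeasurable (ae_of_all _ fun y => hC y trivial)

lemma integrableOn_mul_legendreFun (n : ℕ) {f : ℝ → ℂ} (hf : IntegrableOn f (Set.Ioc 0 1)) :
    IntegrableOn (fun u => f u * (legendreFun n u : ℂ)) (Set.Ioc 0 1) := by
  obtain ⟨C, hC⟩ := (isCompact_Icc (a := (0 : ℝ)) (b := 1)).exists_bound_of_continuousOn
    (f := fun u => (legendreFun n u : ℂ)) (by fun_prop)
  refine Integrable.mul_bdd (c := C) hf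
    (by fun_prop : Continuous fun u => (legendreFun n u : ℂ)).aestronglyMeasurable ?_
  filter_upwards [ae_restrict_mem measurableSet_Ioc] with u hu
  exact hC u (Set.Ioc_subset_Icc_self hu)

/-- The **Funk–Hecke formula** for integrable zonal kernels. -/
theorem funk_hecke (x : UnitSphere) {n : ℕ} {p : MvPolynomial (Fin 3) ℂ}
    (hn : p.IsHomogeneous n) (hp : polyLaplacian p = 0) {f : ℝ → ℂ}
    (hf : IntegrableOn f (Set.Ioc 0 1)) :
    ∫ y : UnitSphere, f (zonalVar x y) * polyEval p y ∂surfaceMeasure =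
      4 * Real.pi * (∫ u in Set.Ioc (0 : ℝ) 1, f u * (legendreFun n u : ℂ)) *
        polyEval p x := by
  obtain ⟨A, hA⟩ := isCompact_univ.exists_bound_of_continuousOn
    (continuous_polyEval_coe p).continuousOn
  obtain ⟨B, hB⟩ := (isCompact_Icc (a := (0 : ℝ)) (b := 1)).exists_bound_of_continuousOn
    (f := fun u => (legendreFun n u : ℂ)) (by fun_prop)
  have hA0 : 0 ≤ A := (norm_nonneg _).trans (hA x trivial)
  have hB0 : 0 ≤ B := (norm_nonneg _).trans (hB 0 (by simp))
  have hpi := Real.pi_pos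
  -- Both sides are `L¹`-continuous in `f`; `K` adds up their Lipschitz constants, and the `1` makes
  -- it positive.
  set K : ℝ := 4 * Real.pi * A + 4 * Real.pi * B * A + 1
  have hK : 0 < K := by positivity
  refine eq_of_forall_dist_le fun ε hε => ?_
  obtain ⟨g, hg⟩ := exists_polynomial_integral_norm_sub_le hf (div_pos hε hK)
  have hgi : IntegrableOn (fun u : ℝ => g.eval (u : ℂ)) (Set.Ioc 0 1) :=
    (by fun_prop : Continuous fun u : ℝ => g.eval (u : ℂ)).integrableOn_Icc.mono_set
      Set.Ioc_subset_Icc_self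
  have hfg : IntegrableOn (fun u : ℝ => f u - g.eval (u : ℂ)) (Set.Ioc 0 1) := hf.sub hgi
  set δ := ∫ u in Set.Ioc (0 : ℝ) 1, ‖f u - g.eval (u : ℂ)‖
  have b1 : ‖∫ y : UnitSphere, (f (zonalVar x y) - g.eval (zonalVar x y : ℂ)) * polyEval p y
      ∂surfaceMeasure‖ ≤ 4 * Real.pi * δ * A := by
    rw [← integral_norm_comp_zonalVar x hfg, ← integral_mul_const]
    refine norm_integral_le_of_norm_le
      ((Integrable.norm (integrable_comp_zonalVar x hfg)).mul_const A) (ae_of_all _ fun y => ?_)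
    rw [norm_mul]
    gcongr
    exact hA y trivial
  have b2 : ‖∫ u in Set.Ioc (0 : ℝ) 1, (f u - g.eval (u : ℂ)) * (legendreFun n u : ℂ)‖ ≤
      δ * B := by
    rw [← integral_mul_const]
    refine norm_integral_le_of_norm_le ((Integrable.norm hfg).mul_const B) ?_
    filter_upwards [ae_restrict_mem measurableSet_Ioc] with u hu
    rw [norm_mul]
    gcongr
    exact hB u (Set.Ioc_subset_Icc_self hu)
  simp only [sub_mul] at b1 b2
  rw [integral_sub (integrable_zonal_mul_polyEval x p hf) (integrable_zonal_mul_polyEval x p hgi),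
    integral_polynomial_zonalVar x hn hp g] at b1
  rw [integral_sub (integrableOn_mul_legendreFun n hf) (integrableOn_mul_legendreFun n hgi)] at b2
  rw [dist_eq_norm]
  set I := ∫ y : UnitSphere, f (zonalVar x y) * polyEval p y ∂surfaceMeasure
  set J := ∫ u in Set.Ioc (0 : ℝ) 1, f u * (legendreFun n u : ℂ)
  set L := ∫ u in Set.Ioc (0 : ℝ) 1, g.eval (u : ℂ) * (legendreFun n u : ℂ)
  have hδ : 0 ≤ δ := integral_nonneg fun _ => norm_nonneg _
  calc ‖I - 4 * Real.pi * J * polyEval p x‖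
      = ‖(I - 4 * Real.pi * L * polyEval p x) - 4 * Real.pi * (J - L) * polyEval p x‖ := by
        congr 1
        ring
    _ ≤ ‖I - 4 * Real.pi * L * polyEval p x‖ + ‖4 * Real.pi * (J - L) * polyEval p x‖ :=
        norm_sub_le _ _
    _ ≤ 4 * Real.pi * δ * A + 4 * Real.pi * (δ * B) * A := by
        have : ‖(4 * Real.pi * (J - L) * polyEval p x : ℂ)‖ =
            4 * Real.pi * ‖J - L‖ * ‖polyEval p x‖ := by
          simp [abs_of_pos hpi]
        rw [this]
        gcongr
        exact hA x trivial
    _ ≤ K * δ := by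
        simp only [K]
        nlinarith
    _ ≤ K * (ε / K) := by gcongr
    _ = ε := by field_simp

/-! ### The Neumann–Poincaré kernel -/

/-- The kernel of the Neumann–Poincaré operator as a function of the zonal variable `u`, for which
`|x - y| = 2 √u`. -/
def npProfile (k u : ℝ) : ℂ :=
  Complex.exp (Complex.I * k * (2 * √u : ℝ)) * (1 - Complex.I * k * (2 * √u : ℝ)) /
    (16 * Real.pi * (√u : ℝ))

/-- The radial derivative `exp(ikr)(1 - ikr) / (4πr²)` is multiplied by `(x - y) · x / r = r / 2`,
which removes one order of the singularity. -/
lemma npKernel_eq (k : ℝ) {x y : UnitSphere} (hxy : x ≠ y) :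
    npKernel k x y = npProfile k (zonalVar x y) := by
  set r : ℝ := ‖(x : Space3) - y‖ with hr
  have hr0 : 0 < r := norm_pos_iff.mpr (sub_ne_zero.mpr fun h => hxy (Subtype.ext h))
  have hsqrt : √(zonalVar x y) = r / 2 := by
    rw [zonalVar, Subtype.dist_eq, dist_eq_norm, ← hr, Real.sqrt_eq_iff_mul_self_eq_of_pos
      (by positivity)]
    ring
  have hinner : inner ℝ ((x : Space3) - y) (x : Space3) = r ^ 2 / 2 := by
    have h1 : r ^ 2 = 2 - 2 * inner ℝ (x : Space3) y := by
      rw [hr, norm_sub_sq_real]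
      simp
      ring
    rw [inner_sub_left, real_inner_self_eq_norm_sq, real_inner_comm, h1]
    simp
    ring
  have hN : HasFDerivAt (fun z : Space3 => ‖z - y‖)
      ((1 / (2 * r)) • (2 • innerSL ℝ ((x : Space3) - y))) x := by
    have h := ((hasFDerivAt_id (𝕜 := ℝ) (x : Space3)).sub_const (y : Space3)).norm_sq.sqrt
      (pow_pos hr0 2).ne'
    simp only [id_eq, Real.sqrt_sq (norm_nonneg _)] at h
    exact h
  have hc : HasDerivAt (fun s : ℝ => (s : ℂ)) 1 r := (hasDerivAt_id r).ofReal_comp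
  have hpi : (Real.pi : ℂ) ≠ 0 := by exact_mod_cast Real.pi_ne_zero
  have hrc : (r : ℂ) ≠ 0 := by exact_mod_cast hr0.ne'
  have hg := (((hc.const_mul (Complex.I * k)).cexp).fun_div (hc.const_mul (4 * (Real.pi : ℂ)))
    (by simp [hpi, hrc])).fun_neg
  have hgN := HasFDerivAt.comp (x : Space3) hg.hasFDerivAt hN
  have hG : HasFDerivAt (fun z : Space3 => helmholtzG k (z - y)) _ (x : Space3) := hgN
  rw [npKernel, hG.fderiv]
  simp only [npProfile, hsqrt, ContinuousLinearMap.comp_apply, smul_apply,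
    innerSL_apply_apply, hinner, ContinuousLinearMap.toSpanSingleton_apply]
  rw [show 2 * (r / 2) = r by ring]
  simp only [Complex.real_smul, smul_eq_mul, nsmul_eq_mul]
  push_cast
  field_simp
  ring

/-- The exponential has modulus one for real `k`. The bound is uniform for bounded `k`, so it also
serves dominated convergence. -/
lemma norm_npProfile_le (k : ℝ) {u : ℝ} (hu : u ∈ Set.Ioc (0 : ℝ) 1) :
    ‖npProfile k u‖ ≤ (1 + 2 * |k|) * u ^ (-1 / 2 : ℝ) := by
  have h0 : 0 < √u := Real.sqrt_pos.mpr hu.1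
  have h1 : √u ≤ 1 := Real.sqrt_le_one.mpr hu.2
  have hpow : u ^ (-1 / 2 : ℝ) = (√u)⁻¹ := by
    rw [Real.sqrt_eq_rpow, ← Real.rpow_neg hu.1.le]
    norm_num
  have he : ‖Complex.exp (Complex.I * k * (2 * √u : ℝ))‖ = 1 := by
    rw [show Complex.I * k * (2 * √u : ℝ) = ((k * (2 * √u) : ℝ) : ℂ) * Complex.I by
      push_cast; ring, Complex.norm_exp_ofReal_mul_I]
  have hb : ‖1 - Complex.I * k * (2 * √u : ℝ)‖ ≤ 1 + 2 * |k| := by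
    refine (norm_sub_le _ _).trans ?_
    simp only [norm_one, norm_mul, Complex.norm_I, Complex.norm_real, one_mul, Real.norm_eq_abs,
      abs_two, abs_of_pos h0]
    nlinarith [abs_nonneg k]
  have hd : ‖(16 * Real.pi * (√u : ℝ) : ℂ)‖ = 16 * Real.pi * √u := by
    simp [abs_of_pos Real.pi_pos, abs_of_pos h0]
  rw [npProfile, norm_div, norm_mul, he, hd, one_mul, hpow, div_eq_mul_inv]
  have hpi : 1 ≤ 16 * Real.pi := by linarith [Real.pi_gt_three]
  gcongr
  nlinarith

lemma measurable_npProfile (k : ℝ) : Measurable (npProfile k) := by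
  unfold npProfile
  fun_prop

lemma integrableOn_rpow_neg_half :
    IntegrableOn (fun u : ℝ => u ^ (-1 / 2 : ℝ)) (Set.Ioc 0 1) :=
  (intervalIntegrable_iff_integrableOn_Ioc_of_le zero_le_one).mp
    (intervalIntegral.intervalIntegrable_rpow' (by norm_num))

lemma integrableOn_npProfile (k : ℝ) : IntegrableOn (npProfile k) (Set.Ioc 0 1) := by
  refine (integrableOn_rpow_neg_half.const_mul (1 + 2 * |k|)).mono'
    (measurable_npProfile k).aestronglyMeasurable ?_
  filter_upwards [ae_restrict_mem measurableSet_Ioc] with u hu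
  exact norm_npProfile_le k hu

lemma surfaceMeasure_singleton (x : UnitSphere) : surfaceMeasure {x} = 0 := by
  refine measure_mono_null (t := zonalVar x ⁻¹' {0}) (by simp [zonalVar]) ?_
  rw [← Measure.map_apply (continuous_zonalVar x).measurable (measurableSet_singleton 0),
    map_zonalVar]
  simp

lemma npKernel_ae_eq (k : ℝ) (x : UnitSphere) :
    ∀ᵐ y ∂surfaceMeasure, npKernel k x y = npProfile k (zonalVar x y) := by
  filter_upwards [compl_mem_ae_iff.mpr (surfaceMeasure_singleton x)] with y hy
  exact npKernel_eq k fun h => hy h.symm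

/-- The truncated domains exhaust the sphere up to the null set `{x}`. -/
lemma hasPVIntegral_of_integrable {F : UnitSphere → ℂ} (hF : Integrable F surfaceMeasure)
    (x : UnitSphere) : HasPVIntegral F x (∫ y, F y ∂surfaceMeasure) := by
  refine ⟨fun ε _ => hF.integrableOn, ?_⟩
  have hcover : AECover surfaceMeasure (𝓝[>] (0 : ℝ)) fun ε => {y | ε < dist x y} := by
    refine ⟨?_, fun ε => (isOpen_lt (by fun_prop) (by fun_prop)).measurableSet⟩
    filter_upwards [compl_mem_ae_iff.mpr (surfaceMeasure_singleton x)] with y hy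
    have : 0 < dist x y := dist_pos.mpr fun h => hy h.symm
    exact mem_nhdsWithin_of_mem_nhds (Iio_mem_nhds this)
  exact hcover.integral_tendsto_of_countably_generated hF

/-! ### Eigenvalues, uniqueness and the static limit -/

/-- The eigenvalue of the Neumann–Poincaré operator on the spherical harmonics of order `n`. -/
def npEigenvalue (n : ℕ) (k : ℝ) : ℂ :=
  4 * Real.pi * ∫ u in Set.Ioc (0 : ℝ) 1, npProfile k u * (legendreFun n u : ℂ)

lemma isNPEigenvalue_npEigenvalue (n : ℕ) (k : ℝ) : IsNPEigenvalue n k (npEigenvalue n k) := by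
  rintro Y ⟨p, hn, hp, hY⟩ x
  have hae : (fun y => npKernel k x y * Y y) =ᵐ[surfaceMeasure]
      fun y : UnitSphere => npProfile k (zonalVar x y) * polyEval p y := by
    filter_upwards [npKernel_ae_eq k x] with y hy
    rw [hy, hY]
    rfl
  have hint := (integrable_zonal_mul_polyEval x p (integrableOn_npProfile k)).congr hae.symm
  have h := hasPVIntegral_of_integrable hint x
  rw [integral_congr_ae hae, funk_hecke x hn hp (integrableOn_npProfile k)] at h
  simp only [hY x]
  exact h

/-- The powers of `x₀ + i x₁` are harmonic because its gradient `(1, i, 0)` is isotropic. -/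
lemma exists_sphericalHarmonic_ne_zero (n : ℕ) :
    ∃ (Y : UnitSphere → ℂ) (x : UnitSphere), IsSphericalHarmonic n Y ∧ Y x ≠ 0 := by
  let q : MvPolynomial (Fin 3) ℂ := MvPolynomial.X 0 + MvPolynomial.C Complex.I * MvPolynomial.X 1
  have hq : q.IsHomogeneous 1 := (MvPolynomial.isHomogeneous_X _ _).add (by
    simpa using (MvPolynomial.isHomogeneous_C (Fin 3) Complex.I).mul
      (MvPolynomial.isHomogeneous_X ℂ 1))
  have h0 : MvPolynomial.pderiv 0 q = 1 := by simp [q, MvPolynomial.pderiv_X]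
  have h1 : MvPolynomial.pderiv 1 q = MvPolynomial.C Complex.I := by
    simp [q, MvPolynomial.pderiv_X]
  have h2 : MvPolynomial.pderiv 2 q = 0 := by simp [q, MvPolynomial.pderiv_X]
  have hI : (MvPolynomial.C Complex.I : MvPolynomial (Fin 3) ℂ) ^ 2 = -1 := by
    rw [← map_pow, Complex.I_sq]
    simp
  refine ⟨fun y => polyEval (q ^ n) y, ⟨EuclideanSpace.single 0 1, by simp⟩,
    ⟨q ^ n, by simpa using hq.pow n, ?_, fun _ => rfl⟩, ?_⟩
  · have hC : ∀ m : ℕ, (m : MvPolynomial (Fin 3) ℂ) = MvPolynomial.C (m : ℂ) := by simp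
    simp only [Fin.sum_univ_three, MvPolynomial.pderiv_pow, h0, h1, h2, hC,
      MvPolynomial.pderiv_mul, MvPolynomial.pderiv_C, map_zero, MvPolynomial.pderiv_one]
    linear_combination (MvPolynomial.C (n : ℂ) * MvPolynomial.C ((n - 1 : ℕ) : ℂ) *
      q ^ (n - 1 - 1)) * hI
  · simp [q]

lemma IsNPEigenvalue.unique {n : ℕ} {k : ℝ} {c c' : ℂ} (h : IsNPEigenvalue n k c)
    (h' : IsNPEigenvalue n k c') : c = c' := by
  obtain ⟨Y, x, hY, hx⟩ := exists_sphericalHarmonic_ne_zero n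
  exact mul_right_cancel₀ hx (tendsto_nhds_unique (h Y hY x).2 (h' Y hY x).2)

lemma npEigenvalue_zero (n : ℕ) : npEigenvalue n 0 = 1 / (2 * (2 * (n : ℂ) + 1)) := by
  have h : ∀ u ∈ Set.Ioc (0 : ℝ) 1, npProfile 0 u * (legendreFun n u : ℂ) =
      1 / (16 * Real.pi) * ((u ^ (-1 / 2 : ℝ) * legendreFun n u : ℝ) : ℂ) := by
    intro u hu
    have hpow : u ^ (-1 / 2 : ℝ) = (√u)⁻¹ := by
      rw [Real.sqrt_eq_rpow, ← Real.rpow_neg hu.1.le]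
      norm_num
    rw [hpow, npProfile]
    simp
    ring
  rw [npEigenvalue, setIntegral_congr_fun measurableSet_Ioc h, integral_const_mul,
    integral_complex_ofReal, ← intervalIntegral.integral_of_le zero_le_one,
    integral_rpow_mul_legendreFun n (by norm_num), legendreMoment_neg_half]
  have hpi : (Real.pi : ℂ) ≠ 0 := by exact_mod_cast Real.pi_ne_zero
  have hn : (2 * (n : ℂ) + 1) ≠ 0 := by norm_cast
  push_cast
  field_simp
  norm_num

lemma tendsto_npEigenvalue (n : ℕ) :
    Tendsto (npEigenvalue n) (𝓝 0) (𝓝 (npEigenvalue n 0)) := by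
  refine Tendsto.const_mul _ ?_
  refine tendsto_integral_filter_of_dominated_convergence
    -- The constant `3` bounds `1 + 2|k|` for `|k| ≤ 1`.
    (fun u => 3 * u ^ (-1 / 2 : ℝ) * |legendreFun n u|) ?_ ?_ ?_ ?_
  · exact Eventually.of_forall fun k =>
      (integrableOn_mul_legendreFun n (integrableOn_npProfile k)).aestronglyMeasurable
  · filter_upwards [Metric.ball_mem_nhds (0 : ℝ) one_pos] with k hk
    filter_upwards [ae_restrict_mem measurableSet_Ioc] with u hu
    have hk' : |k| ≤ 1 := by simpa using (mem_ball_zero_iff.mp hk).le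
    rw [norm_mul, Complex.norm_real, Real.norm_eq_abs]
    gcongr
    refine (norm_npProfile_le k hu).trans ?_
    have := Real.rpow_nonneg hu.1.le (-1 / 2)
    gcongr
    linarith
  · have h := (integrableOn_mul_legendreFun n (f := fun u => ((3 * u ^ (-1 / 2 : ℝ) : ℝ) : ℂ))
      (integrableOn_rpow_neg_half.const_mul 3).ofReal).norm
    refine h.congr ?_
    filter_upwards [ae_restrict_mem measurableSet_Ioc] with u hu
    have := Real.rpow_nonneg hu.1.le (-1 / 2)
    rw [norm_mul, Complex.norm_real, Complex.norm_real, Real.norm_eq_abs, Real.norm_eq_abs,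
      abs_of_nonneg (by positivity)]
  · refine ae_of_all _ fun u => ?_
    have hc : Continuous fun k : ℝ => npProfile k u * (legendreFun n u : ℂ) := by
      unfold npProfile
      fun_prop
    exact hc.tendsto 0

end

theorem theorem3p3 (n : ℕ) :
    (∀ k : ℝ, ∃! c : ℂ, IsNPEigenvalue n k c) ∧
      (∀ τ : ℝ → ℂ, (∀ k : ℝ, k ≠ 0 → IsNPEigenvalue n k (τ k)) →
        Tendsto τ (𝓝[≠] 0) (𝓝 (1 / (2 * (2 * (n : ℂ) + 1))))) ∧
      IsNPEigenvalue n 0 (1 / (2 * (2 * (n : ℂ) + 1))) := by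
  refine ⟨fun k => ⟨npEigenvalue n k, isNPEigenvalue_npEigenvalue n k,
    fun c hc => hc.unique (isNPEigenvalue_npEigenvalue n k)⟩, fun τ hτ => ?_, ?_⟩
  · rw [← npEigenvalue_zero]
    -- By uniqueness, any family of eigenvalues agrees with `npEigenvalue n` off `k = 0`.
    refine ((tendsto_npEigenvalue n).mono_left nhdsWithin_le_nhds).congr' ?_
    filter_upwards [self_mem_nhdsWithin] with k hk
    exact (isNPEigenvalue_npEigenvalue n k).unique (hτ k hk)
  · rw [← npEigenvalue_zero]
    exact isNPEigenvalue_npEigenvalue n 0
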